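/- Let $(X_i)_{i\in I}$ be an arbitrary family of scattered Eberlein compact spaces, let $a=(a_i)_{i\in I}\in\prod_{i\in I}X_i$, and let $$\sigma(a)=\Big\{x\in\prod_{i\in I}X_i : \{i\in I : x_i\neq a_i\}\text{ is finite}\Big\}$$ be the $\sigma$-product of the family with base point $a$, with the topology of a subspace of the Tychonoff product. Then $\sigma(a)$ is a $\Delta$-space. Here a topological space is an *Eberlein compact* space if it is homeomorphic to a weakly compact subset of a Banach space, with the weak topology. A space $X$ is *scattered* if every nonempty subset $A\subseteq X$ has a point that is isolated in $A$. A space $X$ is a *$\Delta$-space* if for every decreasing sequence $(D_n)_{n\in\omega}$ of subsets of $X$ with $\bigcap_n D_n=\emptyset$ there is a decreasing sequence $(V_n)_{n\in\omega}$ of open subsets of $X$ with $\bigcap_n V_n=\emptyset$ and $D_n\subseteq V_n$ for every $n\in\omega$. -/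

import Mathlib

universe u

/-- `X` is a Δ-space: every decreasing sequence of subsets of `X` with empty intersection can be
expanded to a decreasing sequence of open subsets which still has empty intersection. -/
def IsDeltaSpace (X : Type*) [TopologicalSpace X] : Prop :=
  ∀ D : ℕ → Set X, Antitone D → ⋂ n, D n = ∅ →
    ∃ V : ℕ → Set X, Antitone V ∧ (∀ n, IsOpen (V n)) ∧ ⋂ n, V n = ∅ ∧ ∀ n, D n ⊆ V n

/-- `X` is scattered: every nonempty subset `A` of `X` has a point that is isolated in `A`. -/
def IsScatteredSpace (X : Type*) [TopologicalSpace X] : Prop :=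
  ∀ A : Set X, A.Nonempty → ∃ x ∈ A, ∃ U : Set X, IsOpen U ∧ U ∩ A = {x}

/-- `X` is an Eberlein compact space: it is homeomorphic to a weakly compact subset of a (real)
Banach space, with the weak topology. There is no loss in taking the Banach space in the universe
of `X`: the closed linear span of a copy of `X` has at most `max (#X) 𝔠` points. -/
def IsEberleinCompact (X : Type u) [TopologicalSpace X] : Prop :=
  ∃ (E : Type u) (_ : NormedAddCommGroup E) (_ : NormedSpace ℝ E) (_ : CompleteSpace E)
    (K : Set (WeakSpace ℝ E)), IsCompact K ∧ Nonempty (X ≃ₜ K)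

/-- The σ-product of the family `X` with base point `a`: the points of the product that differ
from `a` in finitely many coordinates only. Its topology is that of a subspace of the product. -/
def sigmaProduct {ι : Type*} {X : ι → Type*} (a : ∀ i, X i) : Set (∀ i, X i) :=
  {x | {i | x i ≠ a i}.Finite}

/-! A point-finite neighbourhood assignment makes a space a Δ-space, and such assignments pass to
σ-products. It remains to find one on a scattered Eberlein compactum X. Scatteredness gives an
injective ordinal rank with open initial segments, so a nonempty clopen set has a unique point of
maximal rank. The Banach space attaches countably many clopen sets to each finite set of points, so
that finite subsets of any A separate the points of the closure of A. A set closed under taking rank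
maxima of these clopen sets is then topologically closed (`isClosed_of_closedUnder`). Induction on
cardinality (`IsClopenSeparation.exists_pointFinite`) filters an uncountable set by such closed
sets. Each point gets a clopen neighbourhood missing the earlier stages; a point lying in
neighbourhoods from infinitely many layers would produce rank maxima of strictly decreasing rank. -/

open Set Cardinal
-- Point-finite neighbourhood assignments
/-- `X` has a neighbourhood assignment for which every point lies in finitely many of the chosen
neighbourhoods. -/
def HasPointFiniteNhds (X : Type*) [TopologicalSpace X] : Prop :=
  ∃ U : X → Set X, (∀ x, IsOpen (U x) ∧ x ∈ U x) ∧ ∀ y, {x | y ∈ U x}.Finite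

theorem HasPointFiniteNhds.isDeltaSpace {X : Type*} [TopologicalSpace X]
    (h : HasPointFiniteNhds X) : IsDeltaSpace X := by
  obtain ⟨U, hU, hfin⟩ := h
  intro D hD hempty
  refine ⟨fun n => ⋃ x ∈ D n, U x, fun m n hmn => biUnion_subset_biUnion_left (hD hmn),
    fun n => isOpen_biUnion fun x _ => (hU x).1, ?_, fun n x hx => mem_biUnion hx (hU x).2⟩
  refine eq_empty_of_forall_notMem fun y hy => ?_
  have hout : ∀ x, ∃ n, x ∉ D n := fun x => by
    by_contra! hx
    exact (hempty ▸ mem_iInter.2 hx : x ∈ (∅ : Set X))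
  choose n hn using hout
  obtain ⟨N, hN⟩ := ((hfin y).image n).bddAbove
  obtain ⟨x, hx, hyx⟩ := mem_iUnion₂.1 (mem_iInter.1 hy N)
  exact hn x (hD (hN (mem_image_of_mem n hyx)) hx)

/-- The neighbourhood of x restricts only the support of x, and forces its members to differ from a
there. Hence any x whose neighbourhood contains y is supported in the finite support of y, with
finitely many choices per coordinate. -/
theorem HasPointFiniteNhds.sigmaProduct {ι : Type*} {X : ι → Type*} [∀ i, TopologicalSpace (X i)]
    [∀ i, T1Space (X i)] (h : ∀ i, HasPointFiniteNhds (X i)) (a : ∀ i, X i) :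
    HasPointFiniteNhds (sigmaProduct a) := by
  classical
  choose U hU hfin using h
  refine ⟨fun x => {y | ∀ i, x.1 i ≠ a i → y.1 i ∈ U i (x.1 i) \ {a i}}, fun x => ⟨?_, ?_⟩, ?_⟩
  · change IsOpen {y : _root_.sigmaProduct a | ∀ i, x.1 i ≠ a i → y.1 i ∈ U i (x.1 i) \ {a i}}
    have : {y : _root_.sigmaProduct a | ∀ i, x.1 i ≠ a i → y.1 i ∈ U i (x.1 i) \ {a i}} =
        ⋂ i ∈ {i | x.1 i ≠ a i}, (fun y : _root_.sigmaProduct a => y.1 i) ⁻¹'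
          (U i (x.1 i) \ {a i}) := by
      ext y; simp
    rw [this]
    refine Finite.isOpen_biInter x.2 fun i _ => IsOpen.preimage
      ((continuous_apply i).comp continuous_subtype_val) ?_
    exact (hU i _).1.sdiff isClosed_singleton
  · exact fun i hi => ⟨(hU i _).2, hi⟩
  · intro y
    let S : ∀ i, Set (X i) := fun i => if y.1 i = a i then {a i} else insert (a i)
      {x | y.1 i ∈ U i x}
    have hy : {i | y.1 i ≠ a i}.Finite := y.2
    let e : _root_.sigmaProduct a → ∀ i : {i | y.1 i ≠ a i}, X i := fun x i => x.1 i
    have hmem : ∀ x ∈ {x : _root_.sigmaProduct a |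
        y ∈ {y : _root_.sigmaProduct a | ∀ i, x.1 i ≠ a i → y.1 i ∈ U i (x.1 i) \ {a i}}},
        ∀ i, y.1 i = a i → x.1 i = a i := by
      intro x hx i hi
      by_contra hne
      exact (hx i hne).2 hi
    have : Finite {i | y.1 i ≠ a i} := hy
    refine Finite.of_finite_image (f := e) ((Finite.pi' (t := fun i : {i | y.1 i ≠ a i} =>
      insert (a i) {x | y.1 i ∈ U i x}) fun i => (hfin i _).insert _).subset ?_) ?_
    · rintro _ ⟨x, hx, rfl⟩ i
      by_cases hi : x.1 i = a i
      · exact Or.inl hi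
      · exact Or.inr (hx i hi).1
    · intro x hx x' hx' hxx
      refine Subtype.ext (funext fun i => ?_)
      by_cases hi : y.1 i = a i
      · rw [hmem x hx i hi, hmem x' hx' i hi]
      · exact congrFun hxx ⟨i, hi⟩

/-! ### Scattered spaces -/

/-- Enumerate X transfinitely, each time picking an isolated point of what is left; the rank is the
first index of a point. -/
theorem IsScatteredSpace.exists_rank {X : Type u} [TopologicalSpace X] (h : IsScatteredSpace X) :
    ∃ ρ : X → Ordinal.{u}, Function.Injective ρ ∧ ∀ x, IsOpen {y | ρ y ≤ ρ x} := by
  classical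
  rcases isEmpty_or_nonempty X with hX | hX
  · exact ⟨fun _ => 0, fun x => hX.elim x, fun x => hX.elim x⟩
  have hpick : ∃ p : Set X → X, ∀ A : Set X, A.Nonempty →
      p A ∈ A ∧ ∃ U : Set X, IsOpen U ∧ U ∩ A = {p A} := by
    choose! p hp using h
    exact ⟨p, hp⟩
  obtain ⟨p, hp⟩ := hpick
  let x : Ordinal.{u} → X := WellFounded.fix (C := fun _ => X) (wellFounded_lt (α := Ordinal.{u}))
    fun α f => p {f β hβ | (β) (hβ : β < α)}ᶜ
  have hx : ∀ α, x α = p (x '' Iio α)ᶜ := by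
    intro α
    refine (WellFounded.fix_eq _ _ _).trans ?_
    congr 2
    ext y
    simp [x]
  have hex : ∃ α, x '' Iio α = Set.univ := by
    by_contra! hne
    refine not_injective_of_ordinal x fun α β hαβ => ?_
    have key : ∀ α β, α < β → x α ≠ x β := fun α β hlt heq => by
      have := (hp _ (nonempty_compl.2 (hne β))).1
      rw [← hx, ← heq] at this
      exact this ⟨α, hlt, rfl⟩
    rcases lt_trichotomy α β with h | h | h
    · exact (key _ _ h hαβ).elim
    · exact h
    · exact (key _ _ h hαβ.symm).elim
  have hsurj : ∀ y, ∃ α, x α = y := by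
    obtain ⟨α, hα⟩ := hex
    intro y
    obtain ⟨β, -, hβ⟩ := hα.symm ▸ Set.mem_univ y
    exact ⟨β, hβ⟩
  let ρ : X → Ordinal.{u} := fun y => sInf {α | x α = y}
  have hρ : ∀ y, x (ρ y) = y := fun y => csInf_mem (hsurj y)
  have hρle : ∀ α, ρ (x α) ≤ α := fun α => csInf_le' rfl
  have hlt : ∀ α, x '' Iio α = {y | ρ y < α} := by
    intro α
    ext y
    constructor
    · rintro ⟨β, hβ, rfl⟩
      exact (hρle β).trans_lt hβ
    · exact fun hy => ⟨ρ y, hy, hρ y⟩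
  refine ⟨ρ, fun y z hyz => by rw [← hρ y, ← hρ z, hyz], fun y => ?_⟩
  generalize hα : ρ y = α
  induction α using WellFoundedLT.induction generalizing y with
  | ind α ih =>
  have hopen : IsOpen {z | ρ z < α} := by
    have : {z | ρ z < α} = ⋃ w ∈ {w | ρ w < α}, {z | ρ z ≤ ρ w} := by
      ext z
      simp only [mem_ofPred_eq, mem_iUnion, exists_prop]
      exact ⟨fun hz => ⟨z, hz, le_rfl⟩, fun ⟨w, hw, hz⟩ => hz.trans_lt hw⟩
    rw [this]
    exact isOpen_biUnion fun w hw => ih _ hw w rfl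
  have hne : ((x '' Iio α)ᶜ).Nonempty := ⟨y, by rw [hlt]; simp [hα]⟩
  obtain ⟨-, U, hU, hUy⟩ := hp _ hne
  rw [← hx, ← hα, hρ, hα, hlt] at hUy
  -- U meets the complement of the open set of lower ranks in y alone.
  have : {z | ρ z ≤ α} = {z | ρ z < α} ∪ U := by
    ext z
    simp only [mem_ofPred_eq, mem_union]
    have hz := Set.ext_iff.1 hUy z
    have hy := Set.ext_iff.1 hUy y
    simp only [mem_inter_iff, mem_compl_iff, mem_ofPred_eq, not_lt, mem_singleton_iff] at hz hy
    constructor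
    · intro hle
      rcases hle.lt_or_eq with h | h
      · exact Or.inl h
      · right
        have : z = y := by rw [← hρ z, ← hρ y, h, hα]
        exact (hz.2 this).1
    · rintro (h | h)
      · exact h.le
      · by_contra hgt
        have := hz.1 ⟨h, (not_le.1 hgt).le⟩
        exact hgt (this ▸ hα.le)
  rw [this]
  exact hopen.union hU

theorem IsScatteredSpace.totallyDisconnectedSpace {X : Type*} [TopologicalSpace X] [T1Space X]
    (h : IsScatteredSpace X) : TotallyDisconnectedSpace X := by
  refine ⟨fun S _ hS y hy z hz => ?_⟩
  obtain ⟨x, hx, U, hU, hUS⟩ := h S ⟨y, hy⟩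
  have key : ∀ w ∈ S, w = x := by
    intro w hw
    by_contra hne
    have hxU : x ∈ U := (hUS.symm ▸ mem_singleton x : x ∈ U ∩ S).1
    obtain ⟨v, hv, hvU, hvx⟩ := hS U {x}ᶜ hU isOpen_compl_singleton
      (fun v hv => by
        by_cases hvx : v = x
        · exact Or.inl (hvx ▸ hxU)
        · exact Or.inr hvx)
      ⟨x, hx, hxU⟩ ⟨w, hw, hne⟩
    exact hvx (hUS ▸ (⟨hvU, hv⟩ : v ∈ U ∩ S))
  rw [key y hy, key z hz]

/-! ### Hulls under finitary operations -/

/-- A set is closed under a set-valued operation on finite sets if it contains the values at all its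
nonempty finite subsets. -/
def ClosedUnder {X : Type*} (c : Finset X → Set X) (A : Set X) : Prop :=
  ∀ F : Finset X, F.Nonempty → ↑F ⊆ A → c F ⊆ A

/-- The least set containing `S` which is closed under `c`. -/
def hull {X : Type*} (c : Finset X → Set X) (S : Set X) : Set X :=
  ⋂₀ {A | S ⊆ A ∧ ClosedUnder c A}

section hull
variable {X : Type*} {c : Finset X → Set X}

theorem subset_hull (S : Set X) : S ⊆ hull c S := subset_sInter fun _ h => h.1

theorem hull_subset {S A : Set X} (h : S ⊆ A) (hA : ClosedUnder c A) : hull c S ⊆ A :=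
  sInter_subset_of_mem ⟨h, hA⟩

theorem closedUnder_hull (S : Set X) : ClosedUnder c (hull c S) := fun F hF hFS =>
  subset_sInter fun _ h => h.2 F hF (hFS.trans (hull_subset h.1 h.2))

theorem hull_mono {S T : Set X} (h : S ⊆ T) : hull c S ⊆ hull c T :=
  hull_subset (h.trans (subset_hull T)) (closedUnder_hull T)

/-- The operation is finitary. Nonemptiness of G later allows choosing its last point in an
enumeration. -/
theorem exists_finset_mem_hull {S : Set X} {z : X} (hz : z ∈ hull c S) :
    ∃ G : Finset X, G.Nonempty ∧ ↑G ⊆ S ∧ z ∈ hull c G := by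
  classical
  let A : Set X := {z | ∃ G : Finset X, G.Nonempty ∧ ↑G ⊆ S ∧ z ∈ hull c G}
  have hSA : S ⊆ A := fun x hx => ⟨{x}, by simp, by simpa using hx, subset_hull _ (by simp)⟩
  have hA : ClosedUnder c A := by
    intro F hF hFS w hw
    choose! G hG hGS hGz using hFS
    refine ⟨F.biUnion G, ?_, ?_, ?_⟩
    · obtain ⟨x, hx⟩ := hF
      obtain ⟨y, hy⟩ := hG hx
      exact ⟨y, Finset.mem_biUnion.2 ⟨x, hx, hy⟩⟩
    · intro y hy
      obtain ⟨x, hx, hy⟩ := Finset.mem_biUnion.1 hy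
      exact hGS hx hy
    · refine closedUnder_hull _ F hF (fun x hx => ?_) hw
      refine hull_mono ?_ (hGz hx)
      exact fun y hy => Finset.mem_biUnion.2 ⟨x, hx, hy⟩
  exact hull_subset hSA hA hz

theorem mk_hull_le {X : Type*} {c : Finset X → Set X} (hc : ∀ F, (c F).Countable) (S : Set X) :
    #(hull c S) ≤ max #S ℵ₀ := by
  classical
  let step : Set X → Set X := fun A =>
    A ∪ ⋃ F : Finset A, c (F.map (Function.Embedding.subtype (· ∈ A)))
  let T : ℕ → Set X := fun n => step^[n] S
  have hT : ∀ n, T (n + 1) = T n ∪ ⋃ F : Finset (T n),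
      c (F.map (Function.Embedding.subtype (· ∈ T n))) := fun n =>
    Function.iterate_succ_apply' step n S
  have hmono : Monotone T := monotone_nat_of_le_succ fun n => by
    rw [hT]; exact subset_union_left
  have hcard : ∀ n, #(T n) ≤ max #S ℵ₀ := by
    intro n
    induction n with
    | zero => exact le_max_left _ _
    | succ n ih =>
      have hfin : #(Finset (T n)) ≤ max #S ℵ₀ := by
        rcases finite_or_infinite (T n) with h | h
        · exact (mk_le_aleph0).trans (le_max_right _ _)
        · rw [mk_finset_of_infinite]; exact ih
      rw [hT]
      refine (mk_union_le _ _).trans (add_le_of_le (le_max_right _ _) ih ?_)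
      refine (mk_iUnion_le _).trans (mul_le_of_le (le_max_right _ _) hfin ?_)
      exact ciSup_le' fun F => (hc _).le_aleph0.trans (le_max_right _ _)
  have hsub : hull c S ⊆ ⋃ n, T n := by
    refine hull_subset (subset_iUnion T 0) fun F hF hFT => ?_
    obtain ⟨n, hn⟩ : ∃ n, (F : Set X) ⊆ T n :=
      Directed.exists_mem_subset_of_finset_subset_biUnion hmono.directed_le hFT
    refine Subset.trans ?_ (subset_iUnion T (n + 1))
    rw [hT]
    refine Subset.trans ?_ subset_union_right
    refine Subset.trans ?_ (subset_iUnion (fun G : Finset (T n) =>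
      c (G.map (Function.Embedding.subtype (· ∈ T n)))) (F.subtype (· ∈ T n)))
    simp only [Finset.subtype_map_of_mem hn]
    exact Subset.rfl
  refine (mk_le_mk_of_subset hsub).trans ?_
  have := mk_iUnion_le_lift T
  rw [mk_nat, lift_aleph0, Cardinal.lift_uzero] at this
  refine this.trans (mul_le_of_le (le_max_right _ _) (le_max_right _ _) (ciSup_le' fun n => ?_))
  rw [Cardinal.lift_uzero]
  exact hcard n

end hull

/-! ### Rank maxima and clopen separations -/

/-- Finitely many of the open initial segments cover B, and they form a chain. -/
theorem IsCompact.exists_rank_max {X : Type*} [TopologicalSpace X] {ρ : X → Ordinal}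
    (hopen : ∀ x, IsOpen {y | ρ y ≤ ρ x}) {B : Set X} (hB : IsCompact B) (hne : B.Nonempty) :
    ∃ t ∈ B, ∀ y ∈ B, ρ y ≤ ρ t := by
  refine hB.induction_on (p := fun S => ∃ t ∈ B, ∀ y ∈ S, ρ y ≤ ρ t) ?_ ?_ ?_ ?_
  · obtain ⟨t, ht⟩ := hne
    exact ⟨t, ht, by simp⟩
  · rintro S T hST ⟨t, ht, h⟩
    exact ⟨t, ht, fun y hy => h y (hST hy)⟩
  · rintro S T ⟨t, ht, h⟩ ⟨t', ht', h'⟩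
    rcases le_total (ρ t) (ρ t') with hle | hle
    · exact ⟨t', ht', fun y hy => hy.elim (fun hy => (h y hy).trans hle) (h' y)⟩
    · exact ⟨t, ht, fun y hy => hy.elim (h y) fun hy => (h' y hy).trans hle⟩
  · exact fun x hx => ⟨_, mem_nhdsWithin_of_mem_nhds ((hopen x).mem_nhds (mem_ofPred.2 le_rfl)), x, hx,
      fun y hy => hy⟩

/-- A monotone assignment of countable families of clopen sets, closed under intersections, to the
finite sets of points, such that for every set `A` the families assigned to the finite subsets of
`A` separate the points of the closure of `A`. -/
structure IsClopenSeparation {X : Type*} [TopologicalSpace X] (b : Finset X → Set (Set X)) :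
    Prop where
  countable : ∀ F, (b F).Countable
  isClopen : ∀ F, ∀ B ∈ b F, IsClopen B
  mono : Monotone b
  inter_mem : ∀ F, ∀ B ∈ b F, ∀ B' ∈ b F, B ∩ B' ∈ b F
  univ_mem : ∀ F, Set.univ ∈ b F
  separates : ∀ A : Set X, ∀ x ∈ closure A, ∀ y ∈ closure A, x ≠ y →
    ∃ F : Finset X, ↑F ⊆ A ∧ ∃ B ∈ b F, x ∈ B ∧ y ∉ B

/-- The points of maximal rank in the sets of a family. -/
def rankMaxima {X : Type*} (ρ : X → Ordinal) (b : Finset X → Set (Set X)) (F : Finset X) : Set X :=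
  ⋃ B ∈ b F, {t | t ∈ B ∧ ∀ y ∈ B, ρ y ≤ ρ t}

theorem countable_rankMaxima {X : Type*} {ρ : X → Ordinal} (hρ : Function.Injective ρ)
    {b : Finset X → Set (Set X)} {F : Finset X} (hb : (b F).Countable) :
    (rankMaxima ρ b F).Countable :=
  hb.biUnion fun _ _ => Set.Subsingleton.countable fun s hs t ht =>
    hρ ((ht.2 s hs.1).antisymm (hs.2 t ht.1))

namespace IsClopenSeparation
variable {X : Type*} [TopologicalSpace X] {b : Finset X → Set (Set X)}

theorem exists_disjoint (hb : IsClopenSeparation b) {A C : Set X} {z : X} (hz : z ∈ closure A)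
    (hC : IsCompact C) (hCA : C ⊆ closure A) (hzC : z ∉ C) :
    ∃ F : Finset X, F.Nonempty ∧ ↑F ⊆ A ∧ ∃ B ∈ b F, z ∈ B ∧ Disjoint B C := by
  classical
  obtain ⟨a, ha⟩ : A.Nonempty := closure_nonempty_iff.1 ⟨z, hz⟩
  refine hC.induction_on (p := fun C => ∃ F : Finset X, F.Nonempty ∧ ↑F ⊆ A ∧
    ∃ B ∈ b F, z ∈ B ∧ Disjoint B C) ?_ ?_ ?_ ?_
  · exact ⟨{a}, by simp, by simpa using ha, Set.univ, hb.univ_mem _, mem_univ z, by simp⟩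
  · rintro S T hST ⟨F, hF, hFA, B, hB, hzB, hd⟩
    exact ⟨F, hF, hFA, B, hB, hzB, hd.mono_right hST⟩
  · rintro S T ⟨F, hF, hFA, B, hB, hzB, hd⟩ ⟨F', hF', hFA', B', hB', hzB', hd'⟩
    refine ⟨F ∪ F', hF.mono Finset.subset_union_left, by simp [hFA, hFA'], B ∩ B',
      hb.inter_mem _ _ (hb.mono Finset.subset_union_left hB) _
        (hb.mono Finset.subset_union_right hB'), ⟨hzB, hzB'⟩, ?_⟩
    exact disjoint_union_right.2 ⟨hd.mono_left inter_subset_left, hd'.mono_left inter_subset_right⟩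
  · intro y hy
    obtain ⟨F, hFA, B, hB, hzB, hyB⟩ :=
      hb.separates A z hz y (hCA hy) (ne_of_mem_of_not_mem hy hzC).symm
    refine ⟨Bᶜ, mem_nhdsWithin_of_mem_nhds ((hb.isClopen F B hB).compl.isOpen.mem_nhds hyB),
      insert a F, by simp, ?_, B, hb.mono (Finset.subset_insert _ _) hB, hzB,
      disjoint_compl_right⟩
    simp [insert_subset_iff, ha, hFA]

/-- For z in the closure of A, separate z from the closure points of larger rank by some B. The rank
maximum of B lies in A, so its rank is at most that of z; as z is in B, the two coincide. -/
theorem isClosed_of_closedUnder [CompactSpace X] (hb : IsClopenSeparation b) {ρ : X → Ordinal}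
    (hρ : Function.Injective ρ) (hopen : ∀ x, IsOpen {y | ρ y ≤ ρ x}) {A : Set X}
    (hA : ClosedUnder (rankMaxima ρ b) A) : IsClosed A := by
  refine isClosed_of_closure_subset fun z hz => ?_
  obtain ⟨F, hF, hFA, B, hB, hzB, hd⟩ := hb.exists_disjoint hz
    (C := closure A \ {y | ρ y ≤ ρ z}) (isClosed_closure.sdiff (hopen z)).isCompact
    sdiff_subset (fun h => h.2 (mem_ofPred.2 le_rfl))
  obtain ⟨t, htB, ht⟩ := (hb.isClopen F B hB).isClosed.isCompact.exists_rank_max hopen ⟨z, hzB⟩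
  have htA : t ∈ A := hA F hF hFA (mem_biUnion hB ⟨htB, ht⟩)
  have htz : ρ t ≤ ρ z := by
    by_contra h
    exact disjoint_left.1 hd htB ⟨subset_closure htA, h⟩
  rwa [← hρ (htz.antisymm (ht z hzB))]

end IsClopenSeparation

/-! ### Point-finite assignments by induction on cardinality -/

/-- From V z remove the earlier V w that miss z. If m has least rank among the points whose sets
contain y, a later such z must lie in V m, hence equals m. -/
theorem exists_pointFinite_of_countable {X : Type*} [TopologicalSpace X] {ρ : X → Ordinal}
    (hρ : Function.Injective ρ)
    (hV : ∀ x, ∃ V : Set X, IsClopen V ∧ x ∈ V ∧ ∀ y ∈ V, ρ y ≤ ρ x) {Z : Set X}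
    (hZ : Z.Countable) :
    ∃ U : X → Set X, (∀ z ∈ Z, IsOpen (U z) ∧ z ∈ U z) ∧ ∀ y, {z ∈ Z | y ∈ U z}.Finite := by
  choose V hV hmem hle using hV
  obtain ⟨n, hn⟩ := countable_iff_exists_injOn.1 hZ
  have hfin : ∀ k, {w ∈ Z | n w ≤ k}.Finite := fun k =>
    Finite.of_finite_image ((finite_Iic k).subset (by rintro _ ⟨w, hw, rfl⟩; exact hw.2))
      (hn.mono fun w hw => hw.1)
  refine ⟨fun z => V z \ ⋃ w ∈ {w | w ∈ {w ∈ Z | n w ≤ n z} ∧ z ∉ V w}, V w, fun z _ => ⟨?_, ?_⟩,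
    fun y => ?_⟩
  · refine (hV z).isOpen.sdiff (Finite.isClosed_biUnion ?_ fun w _ => (hV w).isClosed)
    exact (hfin (n z)).subset fun w hw => hw.1
  · refine ⟨hmem z, fun h => ?_⟩
    obtain ⟨w, hw, hzw⟩ := mem_iUnion₂.1 h
    exact hw.2 hzw
  · set N := {z ∈ Z | y ∈ V z \ ⋃ w ∈ {w | w ∈ {w ∈ Z | n w ≤ n z} ∧ z ∉ V w}, V w}
    rcases N.eq_empty_or_nonempty with h | h
    · rw [h]; exact finite_empty
    obtain ⟨m, hmN, hm⟩ := exists_minimalFor_of_wellFoundedLT (· ∈ N) ρ h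
    refine (hfin (n m)).subset fun z hz => ⟨hz.1, ?_⟩
    by_contra hlt
    have hzm : z ∈ V m := by
      by_contra hzm
      exact hz.2.2 (mem_biUnion (x := m) ⟨⟨hmN.1, (not_le.1 hlt).le⟩, hzm⟩ hmN.2.1)
    have : z = m := hρ ((hle m z hzm).antisymm (hm hz (hle m z hzm)))
    exact hlt (this ▸ le_rfl)

/-- An uncountable set is exhausted by an increasing family of sets closed under `c`, in which every
point appears at a successor step and each step adds fewer points than there are in total. -/
theorem exists_hull_filtration {X : Type u} {c : Finset X → Set X} (hc : ∀ F, (c F).Countable)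
    {Z : Set X} (hZ : ℵ₀ < #Z) :
    ∃ (A : Ordinal.{u} → Set X) (i : X → Ordinal.{u}), Monotone A ∧ (∀ ξ, ClosedUnder c (A ξ)) ∧
      (∀ z ∈ Z, z ∈ A (Order.succ (i z)) ∧ z ∉ A (i z)) ∧ ∀ ξ, #{z ∈ Z | i z = ξ} < #Z := by
  classical
  obtain ⟨f, hf, hflt⟩ : ∃ f : Z → Ordinal.{u}, Function.Injective f ∧ ∀ z, f z < (#Z).ord := by
    obtain ⟨r, hr, hrZ⟩ := Cardinal.exists_ord_eq Z
    exact ⟨Ordinal.typein r, Ordinal.typein_injective r, fun z => hrZ ▸ Ordinal.typein_lt_type r z⟩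
  let S : Ordinal.{u} → Set X := fun ξ => Subtype.val '' {z : Z | f z < ξ}
  let A : Ordinal.{u} → Set X := fun ξ => hull c (S ξ)
  have hSmono : Monotone S := fun ξ η h => image_mono fun z hz => lt_of_lt_of_le hz h
  have hAmono : Monotone A := fun ξ η h => hull_mono (hSmono h)
  have hmem : ∀ z : Z, (z : X) ∈ A (Order.succ (f z)) := fun z =>
    subset_hull _ ⟨z, mem_ofPred.2 (Order.lt_succ (f z)), rfl⟩
  have hcard : ∀ ξ < (#Z).ord, #(A ξ) < #Z := by
    intro ξ hξ
    refine (mk_hull_le hc _).trans_lt (max_lt ?_ hZ)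
    have h1 : #(S ξ) ≤ ξ.card := by
      refine mk_image_le.trans ?_
      have h2 := lift_mk_le_lift_mk_of_injective
        (f := fun z : {z : Z | f z < ξ} => (⟨f z.1, z.2⟩ : Iio ξ))
        fun z w h => Subtype.ext (hf (congrArg Subtype.val h))
      rw [mk_Iio_ordinal, lift_lift] at h2
      exact lift_le.1 h2
    exact h1.trans_lt (Cardinal.lt_ord.1 hξ)
  let i : X → Ordinal.{u} := fun z => sInf {ξ | z ∈ A (Order.succ ξ)}
  have hile : ∀ z : Z, i z ≤ f z := fun z => csInf_le' (hmem z)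
  have himem : ∀ z ∈ Z, z ∈ A (Order.succ (i z)) := fun z hz =>
    csInf_mem (s := {ξ | z ∈ A (Order.succ ξ)}) ⟨f ⟨z, hz⟩, hmem ⟨z, hz⟩⟩
  refine ⟨A, i, hAmono, fun ξ => closedUnder_hull _, fun z hz => ⟨himem z hz, fun h => ?_⟩, ?_⟩
  -- Finitely many generators below stage i z already produce z; the last of them gives an index
  -- smaller than i z.
  · obtain ⟨G, hG, hGS, hzG⟩ := exists_finset_mem_hull h
    have : Nonempty Z := ⟨⟨z, hz⟩⟩
    have hGS' : ∀ x ∈ G, ∃ w : Z, f w < i z ∧ (w : X) = x := fun x hx => hGS hx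
    choose! g hg hgx using hGS'
    obtain ⟨m, hm, hmax⟩ := G.exists_max_image (fun x => f (g x)) hG
    have : z ∈ A (Order.succ (f (g m))) := by
      refine hull_mono (fun x hx => ?_) hzG
      exact ⟨g x, mem_ofPred.2 (Order.lt_succ_of_le (hmax x hx)), hgx x hx⟩
    exact (lt_of_le_of_lt (csInf_le' this : i z ≤ _) (hg m hm)).false
  · intro ξ
    by_cases hξ : ξ < (#Z).ord
    · refine (mk_le_mk_of_subset ?_).trans_lt (hcard _
        ((Cardinal.isSuccLimit_ord hZ.le).succ_lt hξ))
      rintro z ⟨hz, rfl⟩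
      exact himem z hz
    · have : {z ∈ Z | i z = ξ} = ∅ := by
        refine eq_empty_of_forall_notMem fun z ⟨hz, h⟩ => hξ ?_
        rw [← h]
        exact (hile ⟨z, hz⟩).trans_lt (hflt _)
      rw [this]
      simpa using aleph0_pos.trans hZ

theorem IsClopenSeparation.exists_pointFinite {X : Type u} [TopologicalSpace X] [CompactSpace X]
    {b : Finset X → Set (Set X)} (hb : IsClopenSeparation b) {ρ : X → Ordinal}
    (hρ : Function.Injective ρ) (hopen : ∀ x, IsOpen {y | ρ y ≤ ρ x})
    (hV : ∀ x, ∃ V : Set X, IsClopen V ∧ x ∈ V ∧ ∀ y ∈ V, ρ y ≤ ρ x) (Z : Set X) :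
    ∃ U : X → Set X, (∀ z ∈ Z, IsOpen (U z) ∧ z ∈ U z) ∧ ∀ y, {z ∈ Z | y ∈ U z}.Finite := by
  classical
  generalize hκ : #Z = κ
  induction κ using WellFoundedLT.induction generalizing Z with
  | ind κ ih =>
  subst hκ
  rcases le_or_gt #Z ℵ₀ with hZ | hZ
  · exact exists_pointFinite_of_countable hρ hV (le_aleph0_iff_set_countable.1 hZ)
  obtain ⟨A, i, hmono, hA, hi, hcard⟩ :=
    exists_hull_filtration (fun F => countable_rankMaxima hρ (hb.countable F)) hZ
  choose W hW hWfin using fun ξ => ih _ (hcard ξ) {z ∈ Z | i z = ξ} rfl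
  have hB : ∀ z ∈ Z, ∃ F : Finset X, F.Nonempty ∧ ↑F ⊆ A (Order.succ (i z)) ∧
      ∃ B ∈ b F, z ∈ B ∧ Disjoint B (A (i z)) := fun z hz =>
    hb.exists_disjoint (subset_closure (hi z hz).1)
      (hb.isClosed_of_closedUnder hρ hopen (hA _)).isCompact
      ((hmono (Order.le_succ _)).trans subset_closure) (hi z hz).2
  choose! F hF hFA B hBF hzB hBA using hB
  refine ⟨fun z => B z ∩ W (i z) z, fun z hz =>
    ⟨(hb.isClopen _ _ (hBF z hz)).isOpen.inter (hW (i z) z ⟨hz, rfl⟩).1, hzB z hz,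
      (hW (i z) z ⟨hz, rfl⟩).2⟩, fun y => ?_⟩
  set N := {z ∈ Z | y ∈ B z ∩ W (i z) z}
  have hfib : ∀ ξ, {z ∈ N | i z = ξ}.Finite := fun ξ =>
    (hWfin ξ y).subset fun z hz => ⟨⟨hz.1.1, hz.2⟩, hz.2 ▸ hz.1.2.2⟩
  suffices h : (i '' N).Finite by
    refine (h.biUnion fun ξ _ => hfib ξ).subset fun z hz => ?_
    exact mem_biUnion (mem_image_of_mem i hz) ⟨hz, rfl⟩
  -- Each layer contributes finitely many points, so only infinitely many layers could break
  -- point-finiteness.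
  by_contra hinf
  obtain ⟨s, hsN, hs⟩ : ∃ s : ℕ → X, (∀ n, s n ∈ N) ∧ StrictMono (i ∘ s) := by
    let e := Set.Infinite.natEmbedding _ hinf
    have he : ∀ n, ∃ z ∈ N, i z = e n := fun n => (e n).2
    choose z hz hze using he
    obtain ⟨g, hg | hg⟩ := exists_increasing_or_nonincreasing_subseq (· < ·)
      (fun n => (e n : Ordinal))
    · refine ⟨z ∘ g, fun n => hz _, fun m n hmn => ?_⟩
      simpa [hze] using hg m n hmn
    · have hanti : StrictAnti fun n => (e (g n) : Ordinal) := fun m n hmn =>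
        lt_of_le_of_ne (not_lt.1 (hg m n hmn)) fun h =>
          hmn.ne' (g.injective (e.injective (Subtype.ext h)))
      exact (not_strictAnti_of_wellFoundedLT _ hanti).elim
  let C : ℕ → Set X := fun n => ⋂ k ≤ n, B (s k)
  let G : ℕ → Finset X := fun n => (Finset.range (n + 1)).biUnion fun k => F (s k)
  have hCsucc : ∀ n, C (n + 1) = C n ∩ B (s (n + 1)) := fun n => biInter_le_succ _ n
  have hFG : ∀ n, ∀ k ≤ n, F (s k) ⊆ G n := fun n k hk x hx =>
    Finset.mem_biUnion.2 ⟨k, Finset.mem_range.2 (Nat.lt_succ_of_le hk), hx⟩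
  have hGmono : ∀ n, G n ⊆ G (n + 1) := fun n =>
    Finset.biUnion_subset_biUnion_of_subset_left _ (Finset.range_mono (by omega))
  have hCG : ∀ n, C n ∈ b (G n) := by
    intro n
    induction n with
    | zero => simpa [C] using hb.mono (hFG 0 0 le_rfl) (hBF _ (hsN 0).1)
    | succ n ih =>
      rw [hCsucc]
      exact hb.inter_mem _ _ (hb.mono (hGmono n) ih) _
        (hb.mono (hFG _ _ le_rfl) (hBF _ (hsN _).1))
  have hGA : ∀ n, ↑(G n) ⊆ A (Order.succ (i (s n))) := by
    intro n x hx
    obtain ⟨k, hk, hx⟩ := Finset.mem_biUnion.1 (Finset.mem_coe.1 hx)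
    exact hmono (Order.succ_le_succ (hs.monotone (Nat.le_of_lt_succ (Finset.mem_range.1 hk))))
      (hFA _ (hsN k).1 hx)
  have hyC : ∀ n, y ∈ C n := fun n => mem_iInter₂.2 fun k _ => (hsN k).2.1
  choose t htC ht using fun n =>
    (hb.isClopen _ _ (hCG n)).isClosed.isCompact.exists_rank_max hopen ⟨y, hyC n⟩
  have htA : ∀ n, t n ∈ A (Order.succ (i (s n))) := fun n =>
    hA _ (G n) ((hF _ (hsN n).1).mono (hFG n n le_rfl)) (hGA n) (mem_biUnion (hCG n) ⟨htC n, ht n⟩)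
  -- The maximum of C n is caught by stage i (s n) + 1, which C (n + 1) avoids; since C decreases,
  -- the ranks drop strictly.
  refine not_strictAnti_of_wellFoundedLT (fun n => ρ (t n)) (strictAnti_nat_of_succ_lt fun n => ?_)
  have hmem := htC (n + 1)
  rw [hCsucc] at hmem
  refine lt_of_le_of_ne (ht n _ hmem.1) fun h => ?_
  have hle : Order.succ (i (s n)) ≤ i (s (n + 1)) := Order.succ_le_of_lt (hs (Nat.lt_succ_self n))
  exact disjoint_left.1 (hBA _ (hsN (n + 1)).1) hmem.2 (hmono hle (hρ h ▸ htA n))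

/-! ### Clopen separations from the Banach space -/

/-- Functionals norming a countable dense subset of the span of `F`. -/
theorem exists_countable_norming {E : Type*} [NormedAddCommGroup E] [NormedSpace ℝ E]
    {F : Set E} (hF : F.Finite) :
    ∃ Φ : Set (StrongDual ℝ E), Φ.Countable ∧ ∀ v ∈ Submodule.span ℝ F, ∀ w, ‖w - v‖ < ‖w‖ / 4 →
      ∃ φ ∈ Φ, φ w ≠ 0 := by
  obtain ⟨D, hD, hFD⟩ := (hF.countable.isSeparable.span (R := ℝ) : TopologicalSpace.IsSeparable
    (Submodule.span ℝ F : Set E))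
  choose g hg hgd using fun x : E => exists_dual_vector'' ℝ x
  refine ⟨g '' D, hD.image g, fun v hv w hw => ?_⟩
  obtain ⟨d, hd, hvd⟩ := Metric.mem_closure_iff.1 (hFD hv) (‖w‖ / 4)
    ((norm_nonneg _).trans_lt hw)
  refine ⟨g d, mem_image_of_mem g hd, fun h0 => ?_⟩
  rw [dist_eq_norm] at hvd
  -- Two errors of ‖w‖/4 add up to less than ‖w‖/2. A norming functional of d vanishing at w would
  -- give ‖d‖ ≤ ‖w - d‖, so ‖w‖ ≤ 2‖w - d‖ < ‖w‖.
  have h1 : ‖w - d‖ < ‖w‖ / 2 := by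
    have := norm_add_le (w - v) (v - d)
    rw [sub_add_sub_cancel] at this
    linarith
  have h2 : ‖d‖ ≤ ‖w - d‖ := by
    have h3 : g d (d - w) = ‖d‖ := by rw [map_sub, h0, sub_zero, hgd]; rfl
    calc ‖d‖ = g d (d - w) := h3.symm
      _ ≤ ‖g d (d - w)‖ := le_abs_self _
      _ ≤ 1 * ‖d - w‖ := (g d).le_of_opNorm_le (hg d) _
      _ = ‖w - d‖ := by rw [one_mul, norm_sub_rev]
  have h4 := norm_sub_norm_le w d
  linarith

theorem exists_countable_functionals {X E : Type*} [TopologicalSpace X]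
    [NormedAddCommGroup E] [NormedSpace ℝ E] {e : X → WeakSpace ℝ E} (he : Continuous e)
    (hinj : Function.Injective e) :
    ∃ Φ : Finset X → Set (X → ℝ), (∀ F, (Φ F).Countable) ∧ (∀ F, ∀ φ ∈ Φ F, Continuous φ) ∧
      ∀ A : Set X, ∀ x ∈ closure A, ∀ y ∈ closure A, x ≠ y →
        ∃ F : Finset X, ↑F ⊆ A ∧ ∃ φ ∈ Φ F, φ x ≠ φ y := by
  classical
  let j : X → E := fun x => (toWeakSpace ℝ E).symm (e x)
  have hjinj : Function.Injective j := (toWeakSpace ℝ E).symm.injective.comp hinj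
  have hj : ∀ φ : StrongDual ℝ E, Continuous fun x => φ (j x) := fun φ =>
    (WeakBilin.eval_continuous (topDualPairing ℝ E).flip φ).comp he
  choose Φ hΦ hsep using fun F : Finset X =>
    exists_countable_norming (E := E) ((F.finite_toSet.image j))
  refine ⟨fun F => (fun φ x => φ (j x)) '' Φ F, fun F => (hΦ F).image _, ?_, ?_⟩
  · rintro F _ ⟨φ, -, rfl⟩
    exact hj φ
  intro A x hx y hy hxy
  let M := Submodule.span ℝ (j '' A)
  have hM : ∀ z ∈ closure A, j z ∈ M.topologicalClosure := by
    intro z hz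
    have h1 : e z ∈ closure (toWeakSpace ℝ E '' (M : Set E)) := by
      refine closure_mono ?_ (image_closure_subset_closure_image he (mem_image_of_mem e hz))
      rintro _ ⟨a, ha, rfl⟩
      exact ⟨j a, Submodule.subset_span (mem_image_of_mem j ha), by simp [j]⟩
    -- Mazur: the weak closure of the span is its norm closure, so weak limits of A are norm limits
    -- of combinations of finitely many points of A.
    rw [← Convex.toWeakSpace_closure ℝ M.convex] at h1
    obtain ⟨v, hv, hvz⟩ := h1
    have : j z = v := by simp [j, ← hvz]
    rw [this]
    exact hv
  let w := j x - j y
  have hw : w ∈ closure (M : Set E) := M.topologicalClosure.sub_mem (hM x hx) (hM y hy)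
  have hw0 : 0 < ‖w‖ := norm_pos_iff.2 (sub_ne_zero.2 (hjinj.ne hxy))
  obtain ⟨v, hv, hwv⟩ := Metric.mem_closure_iff.1 hw (‖w‖ / 4) (by positivity)
  rw [dist_eq_norm] at hwv
  obtain ⟨T, hTA, hvT⟩ := Submodule.mem_span_finite_of_mem_span hv
  obtain ⟨F, hFA, rfl⟩ := Finset.subset_set_image_iff.1 hTA
  rw [Finset.coe_image] at hvT
  obtain ⟨φ, hφ, hne⟩ := hsep F v hvT w hwv
  exact ⟨F, hFA, _, mem_image_of_mem _ hφ, fun h => hne (by simp [w, h])⟩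

/-- If countably many continuous functions per finite set of points separate the points of closures,
then so do countably many clopen sets, obtained from rational cuts. -/
theorem exists_isClopenSeparation {X : Type*} [TopologicalSpace X] [CompactSpace X] [T2Space X]
    [TotallyDisconnectedSpace X] {Φ : Finset X → Set (X → ℝ)} (hΦ : ∀ F, (Φ F).Countable)
    (hcont : ∀ F, ∀ φ ∈ Φ F, Continuous φ)
    (hsep : ∀ A : Set X, ∀ x ∈ closure A, ∀ y ∈ closure A, x ≠ y →
      ∃ F : Finset X, ↑F ⊆ A ∧ ∃ φ ∈ Φ F, φ x ≠ φ y) :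
    ∃ b : Finset X → Set (Set X), IsClopenSeparation b := by
  classical
  have hcut : ∀ (φ : X → ℝ) (p q : ℚ), ∃ C : Set X, IsClopen C ∧
      (Continuous φ → p < q → {x | φ x ≤ p} ⊆ C ∧ C ⊆ {x | φ x < q}) := by
    intro φ p q
    by_cases h : Continuous φ ∧ p < q
    · obtain ⟨C, hC, h1, h2⟩ := exists_clopen_of_closed_subset_open
        (isClosed_le h.1 (continuous_const (y := (p : ℝ))))
        (isOpen_lt h.1 (continuous_const (y := (q : ℝ))))
        fun x hx => mem_ofPred.2 (lt_of_le_of_lt (mem_ofPred.1 hx) (Rat.cast_lt.2 h.2))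
      exact ⟨C, hC, fun _ _ => ⟨h1, h2⟩⟩
    · exact ⟨∅, isClopen_empty, fun h1 h2 => (h ⟨h1, h2⟩).elim⟩
  choose C hC hCle using hcut
  -- Ranging over all subsets of F makes the family monotone, which Φ need not be.
  let b₀ : Finset X → Set (Set X) := fun F => ⋃ G ∈ F.powerset, ⋃ φ ∈ Φ G, ⋃ pq : ℚ × ℚ,
    {C φ pq.1 pq.2, (C φ pq.1 pq.2)ᶜ}
  have hb₀ : ∀ F, ∀ B ∈ b₀ F, IsClopen B := by
    intro F B hB
    simp only [b₀, mem_iUnion] at hB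
    obtain ⟨G, -, φ, -, pq, rfl | rfl⟩ := hB
    · exact hC _ _ _
    · exact (hC _ _ _).compl
  have hcount : ∀ F, (b₀ F).Countable := fun F =>
    F.powerset.countable_toSet.biUnion fun G _ => (hΦ G).biUnion fun φ _ =>
      countable_iUnion fun pq => (toFinite _).countable
  have hmono : Monotone b₀ := fun F F' h =>
    biUnion_subset_biUnion_left (Finset.powerset_mono.2 h)
  have hsep' : ∀ A : Set X, ∀ x ∈ closure A, ∀ y ∈ closure A, x ≠ y →
      ∃ F : Finset X, ↑F ⊆ A ∧ ∃ B ∈ b₀ F, x ∈ B ∧ y ∉ B := by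
    intro A x hx y hy hxy
    obtain ⟨F, hFA, φ, hφ, hne⟩ := hsep A x hx y hy hxy
    have hmem : ∀ p q : ℚ, ∀ B : Set X, B = C φ p q ∨ B = (C φ p q)ᶜ → B ∈ b₀ F := by
      intro p q B hB
      simp only [b₀, mem_iUnion]
      exact ⟨F, Finset.mem_powerset_self F, φ, hφ, (p, q), hB⟩
    have key : ∀ x y, φ x < φ y → ∃ p q : ℚ, x ∈ C φ p q ∧ y ∉ C φ p q := by
      intro x y h
      obtain ⟨p, hp, hpy⟩ := exists_rat_btwn h
      obtain ⟨q, hq, hqy⟩ := exists_rat_btwn hpy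
      obtain ⟨h1, h2⟩ := hCle φ p q (hcont F φ hφ) (by exact_mod_cast hq)
      exact ⟨p, q, h1 (mem_ofPred.2 hp.le), fun h => (mem_ofPred.1 (h2 h)).not_gt hqy⟩
    rcases hne.lt_or_gt with h | h
    · obtain ⟨p, q, h1, h2⟩ := key x y h
      exact ⟨F, hFA, _, hmem p q _ (Or.inl rfl), h1, h2⟩
    · obtain ⟨p, q, h1, h2⟩ := key y x h
      exact ⟨F, hFA, _, hmem p q _ (Or.inr rfl), h2, fun h => h h1⟩
  -- Finite intersections keep the family countable; the empty one supplies the whole space.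
  refine ⟨fun F => sInter '' {𝒮 : Set (Set X) | 𝒮.Finite ∧ 𝒮 ⊆ b₀ F}, ⟨?_, ?_, ?_, ?_, ?_, ?_⟩⟩
  · exact fun F => (countable_ofPred_finite_subset (hcount F)).image _
  · rintro F _ ⟨𝒮, ⟨hfin, h𝒮⟩, rfl⟩
    rw [sInter_eq_biInter]
    exact hfin.isClopen_biInter fun B hB => hb₀ F B (h𝒮 hB)
  · exact fun F F' h => image_mono fun 𝒮 h𝒮 => ⟨h𝒮.1, h𝒮.2.trans (hmono h)⟩
  · rintro F _ ⟨𝒮, ⟨hfin, h𝒮⟩, rfl⟩ _ ⟨𝒯, ⟨hfin', h𝒯⟩, rfl⟩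
    exact ⟨𝒮 ∪ 𝒯, ⟨hfin.union hfin', union_subset h𝒮 h𝒯⟩, sInter_union _ _⟩
  · exact fun F => ⟨∅, ⟨finite_empty, empty_subset _⟩, sInter_empty⟩
  · intro A x hx y hy hxy
    obtain ⟨F, hFA, B, hB, hxB, hyB⟩ := hsep' A x hx y hy hxy
    exact ⟨F, hFA, B, ⟨{B}, ⟨finite_singleton B, by simpa using hB⟩, sInter_singleton B⟩, hxB, hyB⟩

/-! ### Scattered Eberlein compacta and their σ-products -/

theorem IsEberleinCompact.compactSpace {X : Type u} [TopologicalSpace X]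
    (h : IsEberleinCompact X) : CompactSpace X := by
  obtain ⟨E, _, _, _, K, hK, ⟨f⟩⟩ := h
  have := isCompact_iff_compactSpace.1 hK
  exact f.symm.compactSpace

theorem IsEberleinCompact.t2Space {X : Type u} [TopologicalSpace X]
    (h : IsEberleinCompact X) : T2Space X := by
  obtain ⟨E, _, _, _, K, hK, ⟨f⟩⟩ := h
  have : T2Space (WeakSpace ℝ E) := inferInstance
  exact f.symm.t2Space

/-- A scattered Eberlein compact space has a point-finite open neighbourhood assignment. -/
theorem IsEberleinCompact.hasPointFiniteNhds {X : Type u} [TopologicalSpace X]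
    (hE : IsEberleinCompact X) (hS : IsScatteredSpace X) : HasPointFiniteNhds X := by
  have := hE.compactSpace
  have := hE.t2Space
  have := hS.totallyDisconnectedSpace
  obtain ⟨E, _, _, _, K, -, ⟨f⟩⟩ := hE
  obtain ⟨Φ, hΦ, hcont, hsep⟩ := exists_countable_functionals
    (continuous_subtype_val.comp f.continuous) (Subtype.val_injective.comp f.injective)
  obtain ⟨b, hb⟩ := exists_isClopenSeparation hΦ hcont hsep
  obtain ⟨ρ, hρ, hopen⟩ := hS.exists_rank
  have hV : ∀ x, ∃ V : Set X, IsClopen V ∧ x ∈ V ∧ ∀ y ∈ V, ρ y ≤ ρ x := fun x =>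
    compact_exists_isClopen_in_isOpen (U := {y | ρ y ≤ ρ x}) (hopen x) (le_refl (ρ x))
  obtain ⟨U, hU, hfin⟩ := hb.exists_pointFinite hρ hopen hV Set.univ
  exact ⟨U, fun x => hU x (Set.mem_univ x), fun y => by simpa using hfin y⟩

theorem corollary2p4 {ι : Type*} {X : ι → Type*} [∀ i, TopologicalSpace (X i)]
    (hE : ∀ i, IsEberleinCompact (X i)) (hS : ∀ i, IsScatteredSpace (X i)) (a : ∀ i, X i) :
    IsDeltaSpace (sigmaProduct a) := by
  have := fun i => (hE i).t2Space
  exact (HasPointFiniteNhds.sigmaProduct (fun i => (hE i).hasPointFiniteNhds (hS i)) a).isDeltaSpace
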